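/- For $k\ge 1$ let $f_k=\prod_{m\ge 1}(1-q^{km})$, and let $a_9(n)$ be the number of $9$-regular cubic partitions of $n$, that is, of partitions of $n$ into parts not divisible by $9$ in which the even parts come in two colours; equivalently, $\sum_{n\ge 0}a_9(n)q^n=\dfrac{f_9f_{18}}{f_1f_2}$. Define integers $m_{i,j}$ ($i,j\ge 1$) as follows. The first three rows of $(m_{i,j})$ are $$(3,0,0,0,\dots),\qquad (2,3^3,0,0,\dots),\qquad (1,3^3,3^5,0,\dots),$$ and for $i\ge 4$ we put $m_{i,1}=0$ and $m_{i,j}=9m_{i-1,j-1}+3m_{i-2,j-1}+m_{i-3,j-1}$ for $j\ge 2$. Let $C=(c_{i,j})_{i,j\ge 1}$ with $c_{i,j}=m_{4i,\,i+j}$, and define the vectors $\mathbf Y_\alpha=(y_{\alpha,1},y_{\alpha,2},\dots)$, which have only finitely many nonzero entries, by $$\mathbf Y_0=(3,0,0,\dots),\qquad \mathbf Y_{\alpha+1}=\mathbf Y_\alpha C\quad(\alpha\ge 0).$$ Then for each $\alpha\ge 0$, as formal power series in $q$, $$\sum_{n\ge 0}a_9\left(3^{\alpha+1}n+3^{\alpha+1}-1\right)q^n=\sum_{i\ge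 1}y_{\alpha,i}\,q^{i-1}\left(\frac{f_3f_6}{f_1f_2}\right)^{4i}.$$ -/

import Mathlib

noncomputable section

namespace RegularCubic

open PowerSeries Finset Nat.Partition

/-! ### The eta-type products `f_k` -/

open scoped PowerSeries.WithPiTopology in
/-- `f_k = ∏_{m ≥ 1} (1 - q ^ (k m))`, an infinite product of formal power series with integer
coefficients (coefficientwise convergence; `q` is `PowerSeries.X`). Meaningful for `k ≥ 1`. -/
def f (k : ℕ) : ℤ⟦X⟧ := ∏' m : ℕ, (1 - X ^ (k * (m + 1)))

/-- The series `f_3 f_6 / (f_1 f_2)`. The denominator has constant coefficient `1`, and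
`invOfUnit _ 1` is its inverse, see `f_one_mul_f_two_mul_invOfUnit`. -/
def quot : ℤ⟦X⟧ := f 3 * f 6 * invOfUnit (f 1 * f 2) 1

/-! ### Regular cubic partitions

A cubic partition of `n` is a partition of `n` in which the even parts come in two colours; it is
`r`-regular if no part is divisible by `r`. -/

/-- The `r`-regular cubic partitions of `n`, as pairs `(lam, mu)` of partitions whose sizes add up
to `n`: `lam` collects the parts of the first colour, and `mu` those of the second colour,
which only even parts can have. No part is divisible by `r`. -/
def regularCubicPartitions (r n : ℕ) : Finset (Σ s : ℕ × ℕ, s.1.Partition × s.2.Partition) :=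
  (antidiagonal n).sigma fun s =>
    restricted s.1 (fun m => ¬ r ∣ m) ×ˢ restricted s.2 (fun m => 2 ∣ m ∧ ¬ r ∣ m)

/-- `a_9(n)`: the number of `9`-regular cubic partitions of `n`. -/
def a9 (n : ℕ) : ℕ := #(regularCubicPartitions 9 n)

/-! ### The matrices `M`, `C` and the vectors `Y_α` -/

/-- The entries `m_{i,j}` (`i, j ≥ 1`) of the matrix `M`: its first three rows are
`(3, 0, 0, …)`, `(2, 27, 0, …)`, `(1, 27, 243, 0, …)`, and for `i ≥ 4` one has `m_{i,1} = 0` and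
`m_{i,j} = 9 m_{i-1,j-1} + 3 m_{i-2,j-1} + m_{i-3,j-1}` for `j ≥ 2`.
(Row `0` and column `0` are not part of the matrix; they are filled with zeros.) -/
def m : ℕ → ℕ → ℤ
  | 1, 1 => 3
  | 2, 1 => 2
  | 2, 2 => 27
  | 3, 1 => 1
  | 3, 2 => 27
  | 3, 3 => 243
  | i + 4, j + 2 => 9 * m (i + 3) (j + 1) + 3 * m (i + 2) (j + 1) + m (i + 1) (j + 1)
  | _, _ => 0

/-- The infinite matrix `C = (c_{i,j})_{i,j ≥ 1}`, `c_{i,j} = m_{4i,i+j}`. -/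
def C : Matrix ℕ+ ℕ+ ℤ := fun i j => m (4 * i) (i + j)

/-- The coefficient vectors `Y_α = (y_{α,1}, y_{α,2}, …)`: `Y_0 = (3, 0, 0, …)` and
`Y_{α+1} = Y_α C`. The sum has only finitely many nonzero terms, see `Y_eq_zero`. -/
def Y : ℕ → ℕ+ → ℤ
  | 0 => fun i => if i = 1 then 3 else 0
  | α + 1 => fun j => ∑ᶠ i : ℕ+, Y α i * C i j

/-! ### Facts showing that the definitions make sense -/

theorem m_eq_zero_of_lt : ∀ i j : ℕ, i < j → m i j = 0
  | 0, j, h => by simp [m]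
  | 1, j + 2, h => by simp [m]
  | 2, j + 3, h => by simp [m]
  | 3, j + 4, h => by simp [m]
  | i + 4, j + 2, h => by
      rw [m, m_eq_zero_of_lt (i + 3) (j + 1) (by omega), m_eq_zero_of_lt (i + 2) (j + 1) (by omega),
        m_eq_zero_of_lt (i + 1) (j + 1) (by omega)]
      simp

/-- `Y_α` has finitely many nonzero entries. -/
theorem Y_eq_zero (α : ℕ) (i : ℕ+) (h : 3 ^ α < (i : ℕ)) : Y α i = 0 := by
  induction α generalizing i with
  | zero =>
    have : i ≠ 1 := by rintro rfl; simp at h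
    simp [Y, this]
  | succ α ih =>
    simp only [Y]
    apply finsum_eq_zero_of_forall_eq_zero
    intro k
    by_cases hk : 3 ^ α < (k : ℕ)
    · rw [ih k hk, zero_mul]
    · rw [C, m_eq_zero_of_lt, mul_zero]
      rw [pow_succ] at h
      omega

theorem Y_support_finite (α : ℕ) : (Function.support (Y α)).Finite := by
  apply (Set.finite_Iic (⟨3 ^ α, by positivity⟩ : ℕ+)).subset
  intro i hi
  by_contra h
  apply hi
  apply Y_eq_zero
  rw [Set.mem_Iic, not_le] at h
  exact h

section Products

open scoped PowerSeries.WithPiTopology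

/-- `∏ (1 - q ^ i)` over the `i ≥ 1` with `p i`. -/
def P (p : ℕ → Prop) [DecidablePred p] : ℤ⟦X⟧ :=
  ∏' i : ℕ, if p (i + 1) then 1 - X ^ (i + 1) else 1

theorem multipliable_P (p : ℕ → Prop) [DecidablePred p] :
    Multipliable fun i : ℕ => if p (i + 1) then (1 : ℤ⟦X⟧) - X ^ (i + 1) else 1 := by
  have key : (fun i : ℕ => if p (i + 1) then (1 : ℤ⟦X⟧) - X ^ (i + 1) else 1) =
      fun i => 1 + (if p (i + 1) then - X ^ (i + 1) else 0) := by
    ext1 i; split_ifs <;> simp [sub_eq_add_neg]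
  rw [key]
  apply WithPiTopology.multipliable_one_add_of_tendsto_order_atTop_nhds_top
  refine ENat.tendsto_nhds_top_iff_natCast_lt.mpr (fun n ↦ Filter.eventually_atTop.mpr ⟨n, ?_⟩)
  intro k hk
  split_ifs
  · rw [order_neg, order_X_pow]
    norm_cast
    omega
  · simp

theorem P_mul (p q r : ℕ → Prop) [DecidablePred p] [DecidablePred q] [DecidablePred r]
    (h : ∀ i, r i ↔ p i ∨ q i) (h' : ∀ i, ¬ (p i ∧ q i)) : P p * P q = P r := by
  rw [P, P, P, ← (multipliable_P p).tprod_mul (multipliable_P q)]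
  refine tprod_congr fun i => ?_
  have := h (i + 1)
  have := h' (i + 1)
  by_cases hp : p (i + 1) <;> by_cases hq : q (i + 1) <;> simp_all

theorem card_mul_P (p : ℕ → Prop) [DecidablePred p] :
    (PowerSeries.mk fun n => (#(restricted n p) : ℤ)) * P p = 1 := by
  rw [powerSeriesMk_card_restricted_eq_tprod, P,
    ← (multipliable_powerSeriesMk_card_restricted ℤ p).tprod_mul (multipliable_P p)]
  rw [tprod_congr (g := fun _ => 1), tprod_one]
  intro i
  split_ifs
  · simp_rw [pow_mul]
    exact WithPiTopology.tsum_pow_mul_one_sub_of_constantCoeff_eq_zero (by simp)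
  · simp

theorem f_eq_P (k : ℕ) (hk : 0 < k) : f k = P (fun i => k ∣ i) := by
  symm
  refine tprod_eq_tprod_of_ne_one_bij (fun i => k * (i.val + 1) - 1) ?_ ?_ ?_
  · intro a b h
    have ha : 0 < k * (a.val + 1) := by positivity
    have hb : 0 < k * (b.val + 1) := by positivity
    have : k * (a.val + 1) = k * (b.val + 1) := by simp only at h; omega
    have := Nat.eq_of_mul_eq_mul_left hk this
    exact SetCoe.ext (by omega)
  · intro i hi
    simp only [Function.mem_mulSupport] at hi
    have hd : k ∣ i + 1 := by
      by_contra h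
      simp [h] at hi
    obtain ⟨j, hj⟩ := hd
    have hj0 : j ≠ 0 := by rintro rfl; simp at hj
    refine ⟨⟨j - 1, ?_⟩, ?_⟩
    · rw [Function.mem_mulSupport, Nat.sub_add_cancel (by omega), ← hj]
      simpa [hj] using hi
    · simp only
      rw [Nat.sub_add_cancel (by omega), ← hj]
      simp
  · intro i
    have : k * (i.val + 1) - 1 + 1 = k * (i.val + 1) := Nat.sub_add_cancel (by
      have : 0 < k * (i.val + 1) := by positivity
      omega)
    simp [this]

/-- The infinite product defining `f k` converges. -/
theorem multipliable_f (k : ℕ) (hk : 0 < k) :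
    Multipliable fun i : ℕ => (1 : ℤ⟦X⟧) - X ^ (k * (i + 1)) := by
  simp_rw [sub_eq_add_neg]
  apply WithPiTopology.multipliable_one_add_of_tendsto_order_atTop_nhds_top
  refine ENat.tendsto_nhds_top_iff_natCast_lt.mpr (fun n ↦ Filter.eventually_atTop.mpr ⟨n, ?_⟩)
  intro i hi
  rw [order_neg, order_X_pow]
  norm_cast
  nlinarith

theorem constantCoeff_f (k : ℕ) (hk : 0 < k) : constantCoeff (f k) = 1 := by
  rw [f, (multipliable_f k hk).map_tprod _ (WithPiTopology.continuous_constantCoeff ℤ)]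
  rw [tprod_congr (g := fun _ => 1), tprod_one]
  intro i
  have : k * (i + 1) ≠ 0 := by positivity
  simp [this]

theorem f_one_mul_f_two_mul_invOfUnit : f 1 * f 2 * invOfUnit (f 1 * f 2) 1 = 1 :=
  mul_invOfUnit _ _ (by simp [constantCoeff_f])

/-- The generating function of `a_9` is `f_9 f_18 / (f_1 f_2)`. -/
theorem mk_a9 : (PowerSeries.mk fun n => (a9 n : ℤ)) = f 9 * f 18 * invOfUnit (f 1 * f 2) 1 := by
  have h0 : (PowerSeries.mk fun n => (a9 n : ℤ)) =
      (PowerSeries.mk fun n => (#(restricted n (fun m => ¬ 9 ∣ m)) : ℤ)) *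
      (PowerSeries.mk fun n => (#(restricted n (fun m => 2 ∣ m ∧ ¬ 9 ∣ m)) : ℤ)) := by
    ext n
    simp [a9, regularCubicPartitions, coeff_mul, card_sigma, card_product]
  have h1 := card_mul_P (fun m => ¬ 9 ∣ m)
  have h2 := card_mul_P (fun m => 2 ∣ m ∧ ¬ 9 ∣ m)
  have e1 : P (fun m => ¬ 9 ∣ m) * f 9 = f 1 := by
    rw [f_eq_P 9 (by norm_num), f_eq_P 1 (by norm_num)]
    exact P_mul _ _ _ (fun i => by simp [em']) (fun i => by simp)
  have e2 : P (fun m => 2 ∣ m ∧ ¬ 9 ∣ m) * f 18 = f 2 := by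
    rw [f_eq_P 18 (by norm_num), f_eq_P 2 (by norm_num)]
    exact P_mul _ _ _ (fun i => by omega) (fun i => by omega)
  have h3 := f_one_mul_f_two_mul_invOfUnit
  rw [h0]
  generalize invOfUnit (f 1 * f 2) 1 = J at *
  rw [← e1, ← e2] at h3
  generalize (PowerSeries.mk fun n => (#(restricted n (fun m => ¬ 9 ∣ m)) : ℤ)) = A at *
  generalize (PowerSeries.mk fun n => (#(restricted n (fun m => 2 ∣ m ∧ ¬ 9 ∣ m)) : ℤ)) = B at *
  generalize P (fun m => ¬ 9 ∣ m) = p at *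
  generalize P (fun m => 2 ∣ m ∧ ¬ 9 ∣ m) = r at *
  calc A * B = A * B * (p * f 9 * (r * f 18) * J) := by rw [h3, mul_one]
    _ = (A * p) * (B * r) * (f 9 * f 18 * J) := by ring
    _ = f 9 * f 18 * J := by rw [h1, h2]; ring

end Products

end RegularCubic

end

noncomputable section

namespace RegularCubic

open PowerSeries Finset

/-! Let U be the operator ∑ a(n) qⁿ ↦ ∑ a(3n) qⁿ (`extractThree`), z = q f₉f₁₈/(f₁f₂) (`shiftedGen`)
and t = q (f₃f₆/(f₁f₂))⁴ (`hauptmodul`). Multiplied by q, the left side at level 0 is U(z), and each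
further level is obtained by applying U again. So it suffices that U(z) = 3t and that U acts on the
powers tⁱ through the matrix `C`.

The action on tⁱ comes from the identity z⁴ = t(q³) t: since U is linear over series in q³, tⁱ U(tⁱ)
= U(z⁴ⁱ). The series U(zⁱ) are polynomials in t with coefficients `m i j`: the recurrence of `m` is
the modular equation z³ = t(q³)(9z² + 3z + 1) (`shiftedGen_cube`), and the first rows record U(z),
U(z²), U(z³).

These inputs rest on the 3-dissection f₁f₂ = a(q³) − q b(q³) − 2q² c(q³) with ac = b²
(`f_one_mul_f_two`, `comp₀_mul_comp₂`), which follows from dissecting φ(−q) and ψ(q), whose product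
is f₁f₂, and from Jacobi's triple product. The product of f₁f₂ over q ↦ ωq, ω³ = 1, is an eta
quotient (`norm_f`); comparing it with the norm form of the dissection gives the modular equation,
and reading off exponents divisible by 3 gives U(z) and U(z²). -/

/-- The triangular number `n (n + 1) / 2`, for an integer `n`. -/
def tri (n : ℤ) : ℕ := (n * (n + 1) / 2).toNat

theorem two_mul_tri (n : ℤ) : 2 * (tri n : ℤ) = n * (n + 1) := by
  have h0 : 0 ≤ n * (n + 1) := by
    rcases le_or_gt 0 n with h | h
    · positivity
    · nlinarith
  rw [tri, Int.toNat_of_nonneg (by omega)]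
  exact Int.mul_ediv_cancel' (Int.even_mul_succ_self n).two_dvd

/-- The general term of the theta series of Jacobi's triple product, in Ramanujan's form. -/
def thetaTerm {A : Type*} [CommRing A] (x y : A) (n : ℤ) : A := x ^ tri n * y ^ tri (-n)

/-! ### Gaussian binomials and the finite triple product -/

section Finite

variable {A : Type*} [CommRing A]

/-- The product `(1 - Q) (1 - Q ^ 2) ⋯ (1 - Q ^ n)`. -/
def qfac (Q : A) (n : ℕ) : A := ∏ i ∈ range n, (1 - Q ^ (i + 1))

@[simp]
theorem qfac_zero (Q : A) : qfac Q 0 = 1 := rfl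

theorem qfac_succ (Q : A) (n : ℕ) : qfac Q (n + 1) = qfac Q n * (1 - Q ^ (n + 1)) :=
  prod_range_succ _ _

/-- The Gaussian binomial coefficient `[a + b, a]`, when the `q`-factorials are units. -/
def gauss (Q : A) (a b : ℕ) : A :=
  qfac Q (a + b) * (Ring.inverse (qfac Q a) * Ring.inverse (qfac Q b))

variable {Q : A} (hQ : ∀ n, IsUnit (qfac Q n))

include hQ

theorem inverse_qfac (n : ℕ) :
    Ring.inverse (qfac Q n) = (1 - Q ^ (n + 1)) * Ring.inverse (qfac Q (n + 1)) := by
  have h1 := Ring.inverse_mul_cancel _ (hQ n)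
  have h2 := Ring.mul_inverse_cancel _ (hQ (n + 1))
  rw [qfac_succ] at h2 ⊢
  linear_combination (-(Ring.inverse (qfac Q n))) * h2 +
    (1 - Q ^ (n + 1)) * Ring.inverse (qfac Q n * (1 - Q ^ (n + 1))) * h1

theorem gauss_zero_left (b : ℕ) : gauss Q 0 b = 1 := by
  have := Ring.mul_inverse_cancel _ (hQ b)
  simp [gauss, this]

theorem gauss_zero_right (a : ℕ) : gauss Q a 0 = 1 := by
  have := Ring.mul_inverse_cancel _ (hQ a)
  simp [gauss, this]

theorem gauss_succ_succ (a b : ℕ) :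
    gauss Q (a + 1) (b + 1) = gauss Q (a + 1) b + Q ^ (b + 1) * gauss Q a (b + 1) := by
  have e1 : a + 1 + (b + 1) = a + b + 1 + 1 := by ring
  have e2 : a + 1 + b = a + b + 1 := by ring
  have e3 : a + (b + 1) = a + b + 1 := by ring
  simp only [gauss, e1, e2, e3, qfac_succ Q (a + b + 1), inverse_qfac hQ a, inverse_qfac hQ b]
  ring

theorem gauss_succ_succ' (a b : ℕ) :
    gauss Q (a + 1) (b + 1) = Q ^ (a + 1) * gauss Q (a + 1) b + gauss Q a (b + 1) := by
  have e1 : a + 1 + (b + 1) = a + b + 1 + 1 := by ring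
  have e2 : a + 1 + b = a + b + 1 := by ring
  have e3 : a + (b + 1) = a + b + 1 := by ring
  simp only [gauss, e1, e2, e3, qfac_succ Q (a + b + 1), inverse_qfac hQ a, inverse_qfac hQ b]
  ring

/-- Pascal's rule, summed against a sequence. -/
theorem sum_antidiagonal_succ_gauss (T : ℕ → A) (L : ℕ) :
    ∑ p ∈ antidiagonal (L + 1), T p.1 * gauss Q p.1 p.2 =
      ∑ p ∈ antidiagonal L, T p.1 * gauss Q p.1 p.2 +
      ∑ p ∈ antidiagonal L, T (p.1 + 1) * Q ^ p.2 * gauss Q p.1 p.2 := by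
  cases L with
  | zero =>
    simp [Finset.Nat.antidiagonal_succ, gauss_zero_left hQ, gauss_zero_right hQ]
  | succ L =>
    -- Pascal's rule needs both arguments positive, so the two end terms, where the Gaussian
    -- binomial is 1, are split off.
    rw [Finset.Nat.antidiagonal_succ_succ']
    rw [Finset.Nat.sum_antidiagonal_succ
      (f := fun p => T p.1 * gauss Q p.1 p.2),
      Finset.Nat.sum_antidiagonal_succ'
      (f := fun p => T (p.1 + 1) * Q ^ p.2 * gauss Q p.1 p.2)]
    simp only [sum_cons, sum_map, Function.Embedding.prodMap, Function.Embedding.coeFn_mk,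
      Prod.map, Nat.succ_eq_add_one, gauss_zero_left hQ, gauss_zero_right hQ,
      gauss_succ_succ hQ, mul_add, sum_add_distrib]
    simp only [mul_assoc]
    ring

/-- Pascal's rule in its second form, summed against a sequence. -/
theorem sum_antidiagonal_succ_gauss' (T : ℕ → A) (L : ℕ) :
    ∑ p ∈ antidiagonal (L + 1), T p.1 * gauss Q p.1 p.2 =
      ∑ p ∈ antidiagonal L, T p.1 * Q ^ p.1 * gauss Q p.1 p.2 +
      ∑ p ∈ antidiagonal L, T (p.1 + 1) * gauss Q p.1 p.2 := by
  cases L with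
  | zero =>
    simp [Finset.Nat.antidiagonal_succ, gauss_zero_left hQ, gauss_zero_right hQ]
  | succ L =>
    rw [Finset.Nat.antidiagonal_succ_succ']
    rw [Finset.Nat.sum_antidiagonal_succ
      (f := fun p => T p.1 * Q ^ p.1 * gauss Q p.1 p.2),
      Finset.Nat.sum_antidiagonal_succ'
      (f := fun p => T (p.1 + 1) * gauss Q p.1 p.2)]
    simp only [sum_cons, sum_map, Function.Embedding.prodMap, Function.Embedding.coeFn_mk,
      Prod.map, Nat.succ_eq_add_one, gauss_zero_left hQ, gauss_zero_right hQ,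
      gauss_succ_succ' hQ, mul_add, sum_add_distrib]
    simp only [mul_assoc, pow_zero]
    ring

omit hQ

/-- Consecutive theta terms have ratio x (xy)ⁿ; the extra power b keeps all exponents nonnegative
and supplies the power of Q in Pascal's rule. -/
theorem thetaTerm_mul_left (x y : A) {n : ℤ} {N b : ℕ} (h : (N : ℤ) = n + b) :
    x * (x * y) ^ N * thetaTerm x y n = thetaTerm x y (n + 1) * (x * y) ^ b := by
  have h1 := two_mul_tri n
  have h2 := two_mul_tri (n + 1)
  have h3 := two_mul_tri (-n)
  have h4 := two_mul_tri (-(n + 1))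
  have e1 : 1 + N + tri n = tri (n + 1) + b := by zify; linarith
  have e2 : N + tri (-n) = tri (-(n + 1)) + b := by zify; linarith
  calc x * (x * y) ^ N * thetaTerm x y n = x ^ (1 + N + tri n) * y ^ (N + tri (-n)) := by
        rw [thetaTerm, mul_pow]; ring
    _ = _ := by rw [e1, e2, thetaTerm, mul_pow]; ring

theorem thetaTerm_neg (x y : A) (n : ℤ) : thetaTerm x y (-n) = thetaTerm y x n := by
  rw [thetaTerm, thetaTerm, neg_neg, mul_comm]

theorem thetaTerm_mul_right (x y : A) {n : ℤ} {M a : ℕ} (h : (a : ℤ) = M + n) :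
    y * (x * y) ^ M * thetaTerm x y n = thetaTerm x y (n - 1) * (x * y) ^ a := by
  have := thetaTerm_mul_left y x (n := -n) (N := M) (b := a) (by omega)
  rw [thetaTerm_neg, mul_comm y x, show -n + 1 = -(n - 1) by ring, thetaTerm_neg] at this
  exact this

/-- The finite form of Jacobi's triple product identity. -/
theorem finite_triple_product (x y : A) (h : ∀ n, IsUnit (qfac (x * y) n)) (N M : ℕ) :
    (∏ k ∈ range N, (1 + x * (x * y) ^ k)) * ∏ k ∈ range M, (1 + y * (x * y) ^ k) =
      ∑ p ∈ antidiagonal (N + M), thetaTerm x y (p.1 - M) * gauss (x * y) p.1 p.2 := by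
  induction N with
  | zero =>
    induction M with
    | zero => simp [thetaTerm, tri, gauss, qfac]
    | succ M ih =>
      rw [prod_range_succ, ← mul_assoc, ih, zero_add, zero_add,
        sum_antidiagonal_succ_gauss' h (fun i => thetaTerm x y (i - (M + 1 : ℕ))),
        mul_add, mul_one, add_comm, sum_mul]
      refine congrArg₂ _ (sum_congr rfl fun p hp => ?_) (sum_congr rfl fun p hp => ?_)
      · have := thetaTerm_mul_right x y (n := p.1 - M) (M := M) (a := p.1) (by omega)
        rw [show (p.1 : ℤ) - M - 1 = p.1 - (M + 1 : ℕ) by push_cast; ring] at this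
        rw [← this]; ring
      · rw [show ((p.1 + 1 : ℕ) : ℤ) - (M + 1 : ℕ) = p.1 - M by push_cast; ring]
  | succ N ih =>
    rw [prod_range_succ, mul_right_comm, ih, show N + 1 + M = N + M + 1 by ring,
      sum_antidiagonal_succ_gauss h (fun i => thetaTerm x y (i - M)), mul_add, mul_one, sum_mul]
    refine congrArg₂ _ rfl (sum_congr rfl fun p hp => ?_)
    have hp' := HasAntidiagonal.mem_antidiagonal.1 hp
    have := thetaTerm_mul_left x y (n := p.1 - M) (N := N) (b := p.2) (by omega)
    rw [show (p.1 : ℤ) - M + 1 = (p.1 + 1 : ℕ) - M by push_cast; ring] at this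
    rw [← this]; ring

theorem finite_triple_product_symm (x y : A) (h : ∀ n, IsUnit (qfac (x * y) n)) (N : ℕ) :
    (∏ k ∈ range N, (1 + x * (x * y) ^ k)) * ∏ k ∈ range N, (1 + y * (x * y) ^ k) =
      ∑ n ∈ Icc (-N : ℤ) N, thetaTerm x y n * gauss (x * y) (N + n).toNat (N - n).toNat := by
  rw [finite_triple_product x y h]
  refine sum_nbij' (fun p => (p.1 : ℤ) - N) (fun n => ((N + n).toNat, (N - n).toNat))
    ?_ ?_ ?_ ?_ ?_
  · intro p hp
    have := HasAntidiagonal.mem_antidiagonal.1 hp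
    simp only [mem_Icc]; omega
  · intro n hn
    simp only [mem_Icc] at hn
    simp only [HasAntidiagonal.mem_antidiagonal]; omega
  · rintro ⟨i, j⟩ hp
    have := HasAntidiagonal.mem_antidiagonal.1 hp
    simp only [Prod.mk.injEq] at *
    omega
  · intro n hn
    simp only [mem_Icc] at hn
    simp only; omega
  · rintro ⟨i, j⟩ hp
    have := HasAntidiagonal.mem_antidiagonal.1 hp
    simp only at *
    congr 2 <;> omega

end Finite

end RegularCubic

end

/-! ### X-adic convergence and Jacobi's triple product -/

noncomputable section

namespace RegularCubic

open PowerSeries Finset Filter Topology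
open scoped PowerSeries.WithPiTopology

theorem X_pow_dvd_mul_pow {R : Type*} [CommRing R] {v c : R⟦X⟧} (hv : X ∣ v) (n : ℕ) :
    X ^ n ∣ c * v ^ n :=
  (pow_dvd_pow_of_dvd hv n).mul_left c

section Convergence

variable {R : Type*} [CommRing R] [TopologicalSpace R]

theorem tendsto_zero_of_X_pow_dvd {g : ℕ → R⟦X⟧} (h : ∀ n, X ^ n ∣ g n) :
    Tendsto g atTop (𝓝 0) := by
  rw [WithPiTopology.tendsto_iff_coeff_tendsto]
  intro d
  refine tendsto_const_nhds.congr' ?_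
  filter_upwards [eventually_gt_atTop d] with n hn
  rw [X_pow_dvd_iff.1 (h n) d hn, map_zero]

/-- Congruences modulo a power of X survive limits, because each low coefficient is eventually
constant. -/
theorem X_pow_dvd_sub_of_tendsto [T2Space R] {g : ℕ → R⟦X⟧} {a b : R⟦X⟧} {k : ℕ}
    (hg : Tendsto g atTop (𝓝 a)) (h : ∀ᶠ n in atTop, X ^ k ∣ g n - b) : X ^ k ∣ a - b := by
  rw [X_pow_dvd_iff]
  intro d hd
  rw [map_sub, sub_eq_zero]
  refine tendsto_nhds_unique ((WithPiTopology.tendsto_iff_coeff_tendsto R _ _ _).1 hg d) ?_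
  refine tendsto_const_nhds.congr' ?_
  filter_upwards [h] with n hn
  have := X_pow_dvd_iff.1 hn d hd
  rw [map_sub, sub_eq_zero] at this
  exact this.symm

theorem multipliable_one_add_of_X_pow_dvd {g : ℕ → R⟦X⟧} (h : ∀ n, X ^ n ∣ g n) :
    Multipliable fun n => 1 + g n := by
  apply WithPiTopology.multipliable_one_add_of_tendsto_order_atTop_nhds_top
  refine ENat.tendsto_nhds_top_iff_natCast_lt.mpr fun n => eventually_atTop.mpr ⟨n + 1, ?_⟩
  intro k hk
  refine lt_of_lt_of_le ?_ (le_order _ k fun i hi => X_pow_dvd_iff.1 (h k) i ?_)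
  · exact_mod_cast hk
  · exact_mod_cast hi

theorem multipliable_one_sub_of_X_pow_dvd {g : ℕ → R⟦X⟧} (h : ∀ n, X ^ n ∣ g n) :
    Multipliable fun n => 1 - g n := by
  simpa only [sub_eq_add_neg] using multipliable_one_add_of_X_pow_dvd fun n => (h n).neg_right

theorem summable_thetaTerm {x : R⟦X⟧} (hx : X ∣ x) (y : R⟦X⟧) : Summable (thetaTerm x y) := by
  rw [WithPiTopology.summable_iff_summable_coeff]
  intro d
  refine summable_of_hasFiniteSupport ((Set.finite_Icc (-(d + 1) : ℤ) (d + 1)).subset fun n hn => ?_)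
  by_contra hc
  refine hn (X_pow_dvd_iff.1 (((pow_dvd_pow_of_dvd hx (tri n)).mul_right _)) d ?_)
  have := two_mul_tri n
  simp only [Set.mem_Icc, not_and_or, not_le] at hc
  zify
  rcases hc with hc | hc <;> nlinarith

end Convergence

section TripleProduct

variable {R : Type*} [CommRing R]

theorem constantCoeff_qfac {Q : R⟦X⟧} (hQ : X ∣ Q) (n : ℕ) : constantCoeff (qfac Q n) = 1 := by
  simp [qfac, X_dvd_iff.1 hQ]

theorem isUnit_qfac {Q : R⟦X⟧} (hQ : X ∣ Q) (n : ℕ) : IsUnit (qfac Q n) := by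
  rw [isUnit_iff_constantCoeff, constantCoeff_qfac hQ]
  exact isUnit_one

theorem X_pow_dvd_qfac_sub {Q : R⟦X⟧} (hQ : X ∣ Q) {m n : ℕ} (h : m ≤ n) :
    X ^ (m + 1) ∣ qfac Q n - qfac Q m := by
  induction n, h using Nat.le_induction with
  | base => simp
  | succ n hn ih =>
    rw [qfac_succ, show qfac Q n * (1 - Q ^ (n + 1)) - qfac Q m =
      qfac Q n - qfac Q m - qfac Q n * Q ^ (n + 1) by ring]
    exact ih.sub ((pow_dvd_pow _ (by omega)).trans (X_pow_dvd_mul_pow hQ _))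

variable [TopologicalSpace R]

theorem tendsto_qfac {Q : R⟦X⟧} (hQ : X ∣ Q) :
    Tendsto (qfac Q) atTop (𝓝 (∏' i : ℕ, (1 - Q ^ (i + 1)))) := by
  refine (multipliable_one_sub_of_X_pow_dvd fun n => ?_).tendsto_prod_tprod_nat
  exact (pow_dvd_pow _ (Nat.le_succ n)).trans (pow_dvd_pow_of_dvd hQ _)

variable [T2Space R]

theorem X_pow_dvd_tprod_sub_qfac {Q : R⟦X⟧} (hQ : X ∣ Q) (m : ℕ) :
    X ^ (m + 1) ∣ ∏' i : ℕ, (1 - Q ^ (i + 1)) - qfac Q m :=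
  X_pow_dvd_sub_of_tendsto (tendsto_qfac hQ)
    ((eventually_ge_atTop m).mono fun _ h => X_pow_dvd_qfac_sub hQ h)

/-- All three q-factorials in the Gaussian binomial agree with the infinite product F modulo
X^(m+1), so the expression reduces to F · F/(F · F). -/
theorem X_pow_dvd_tprod_mul_gauss_sub_one {Q : R⟦X⟧} (hQ : X ∣ Q) {a b m : ℕ}
    (ha : m ≤ a) (hb : m ≤ b) :
    X ^ (m + 1) ∣ (∏' i : ℕ, (1 - Q ^ (i + 1))) * gauss Q a b - 1 := by
  set F := ∏' i : ℕ, (1 - Q ^ (i + 1))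
  have hF : ∀ n, m ≤ n → X ^ (m + 1) ∣ F - qfac Q n := fun n hn =>
    (pow_dvd_pow _ (by omega)).trans (X_pow_dvd_tprod_sub_qfac hQ n)
  have h1 := hF a ha
  have h2 := hF b hb
  have h3 := hF (a + b) (by omega)
  have ea := Ring.mul_inverse_cancel _ (isUnit_qfac hQ a)
  have eb := Ring.mul_inverse_cancel _ (isUnit_qfac hQ b)
  rw [gauss]
  generalize Ring.inverse (qfac Q a) = ia at *
  generalize Ring.inverse (qfac Q b) = ib at *
  have key : F * (qfac Q (a + b) * (ia * ib)) - 1 =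
      (F - qfac Q a) * (qfac Q (a + b) * ia * ib) +
      ((F - qfac Q b) - (F - qfac Q (a + b))) * ib := by
    linear_combination qfac Q (a + b) * ib * ea + eb
  rw [key]
  exact (h1.mul_right _).add ((h2.sub h3).mul_right _)

/-- Jacobi's triple product identity. -/
theorem triple_product [IsTopologicalRing R] {x : R⟦X⟧} (hx : X ∣ x) (y : R⟦X⟧) :
    ∑' n, thetaTerm x y n = (∏' i : ℕ, (1 - (x * y) ^ (i + 1))) *
      ((∏' k : ℕ, (1 + x * (x * y) ^ k)) * ∏' k : ℕ, (1 + y * (x * y) ^ k)) := by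
  have hQ : X ∣ x * y := hx.mul_right y
  set F := ∏' i : ℕ, (1 - (x * y) ^ (i + 1))
  have hlim := ((multipliable_one_add_of_X_pow_dvd
    (X_pow_dvd_mul_pow (c := x) hQ)).tendsto_prod_tprod_nat.mul
    (multipliable_one_add_of_X_pow_dvd
      (X_pow_dvd_mul_pow (c := y) hQ)).tendsto_prod_tprod_nat).const_mul F
  have hsum : Tendsto (fun N : ℕ => ∑ n ∈ Icc (-N : ℤ) N, thetaTerm x y n) atTop
      (𝓝 (∑' n, thetaTerm x y n)) := by
    refine (summable_thetaTerm hx y).hasSum.comp (tendsto_atTop.2 fun s => ?_)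
    filter_upwards [eventually_ge_atTop (∑ n ∈ s, n.natAbs)] with N hN n hn
    have := (single_le_sum (f := Int.natAbs) (fun _ _ => Nat.zero_le _) hn).trans hN
    rw [mem_Icc]; omega
  refine tendsto_nhds_unique hsum ?_
  have hdiff := tendsto_zero_of_X_pow_dvd (R := R) (g := fun N : ℕ => F *
    ((∏ k ∈ range N, (1 + x * (x * y) ^ k)) * ∏ k ∈ range N, (1 + y * (x * y) ^ k)) -
    ∑ n ∈ Icc (-N : ℤ) N, thetaTerm x y n) fun N => ?_
  · simpa using hlim.sub hdiff
  · rw [finite_triple_product_symm x y (isUnit_qfac hQ), mul_sum, ← sum_sub_distrib]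
    refine dvd_sum fun n hn => ?_
    rw [mem_Icc] at hn
    have h1 := X_pow_dvd_tprod_mul_gauss_sub_one hQ (a := (N + n).toNat) (b := (N - n).toNat)
      (m := N - n.natAbs) (by omega) (by omega)
    have h2 : X ^ tri n ∣ thetaTerm x y n := (pow_dvd_pow_of_dvd hx _).mul_right _
    rw [show F * (thetaTerm x y n * gauss (x * y) (N + n).toNat (N - n).toNat) - thetaTerm x y n =
      thetaTerm x y n * (F * gauss (x * y) (N + n).toNat (N - n).toNat - 1) by ring]
    -- The exponents add up to at least N because |n| ≤ n(n+1)/2 + 1, with equality at n = −1 and n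
    -- = −2.
    refine (pow_dvd_pow _ ?_).trans ((pow_add X _ _).dvd.trans (mul_dvd_mul h2 h1))
    have h3 := two_mul_tri n
    zify
    rw [Nat.cast_sub (by omega)]
    rcases abs_cases n with ⟨h, _⟩ | ⟨h, _⟩ <;> push_cast <;> rw [h] <;> nlinarith [sq_nonneg (n+1), sq_nonneg n]

end TripleProduct

end RegularCubic

end

/-! ### Theta functions as eta quotients, and their 3-dissections -/

noncomputable section

namespace RegularCubic

open PowerSeries Finset Filter Topology
open scoped PowerSeries.WithPiTopology

/-- Ramanujan's theta function `∑ x ^ (n (n + 1) / 2) y ^ (n (n - 1) / 2)` over all integers. -/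
def theta {A : Type*} [CommRing A] [TopologicalSpace A] (x y : A) : A := ∑' n, thetaTerm x y n

theorem X_pow_dvd_progression {R : Type*} [CommRing R] {v : R⟦X⟧} (hv : X ∣ v)
    (a : ℕ) {s : ℕ} (hs : 0 < s) (k : ℕ) :
    X ^ k ∣ v ^ (a + s * k) :=
  (pow_dvd_pow _ (by nlinarith)).trans (pow_dvd_pow_of_dvd hv _)

section EtaProducts

variable {R : Type*} [CommRing R] [TopologicalSpace R]

/-- The product `∏ (1 - v ^ (a + s k))` over `k ≥ 0`. -/
def progProd (v : R⟦X⟧) (a s : ℕ) : R⟦X⟧ := ∏' k : ℕ, (1 - v ^ (a + s * k))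

/-- The product `∏ (1 + v ^ (a + s k))` over `k ≥ 0`. -/
def progProdAdd (v : R⟦X⟧) (a s : ℕ) : R⟦X⟧ := ∏' k : ℕ, (1 + v ^ (a + s * k))

theorem multipliable_progProd {v : R⟦X⟧} (hv : X ∣ v) (a : ℕ) {s : ℕ} (hs : 0 < s) :
    Multipliable fun k : ℕ => 1 - v ^ (a + s * k) :=
  multipliable_one_sub_of_X_pow_dvd (X_pow_dvd_progression hv a hs)

theorem multipliable_progProdAdd {v : R⟦X⟧} (hv : X ∣ v) (a : ℕ) {s : ℕ} (hs : 0 < s) :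
    Multipliable fun k : ℕ => 1 + v ^ (a + s * k) :=
  multipliable_one_add_of_X_pow_dvd (X_pow_dvd_progression hv a hs)

theorem prod_range_mul_eq {M : Type*} [CommMonoid M] (g : ℕ → M) (N t : ℕ) :
    ∏ i ∈ range (N * t), g i = ∏ r ∈ range t, ∏ k ∈ range N, g (r + t * k) := by
  induction N with
  | zero => simp
  | succ N ih =>
    rw [Nat.succ_mul, prod_range_add, ih, ← prod_mul_distrib]
    refine prod_congr rfl fun r _ => ?_
    rw [prod_range_succ, add_comm r, mul_comm t]

variable [IsTopologicalRing R] [T2Space R]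

/-- Sorts the factors by their index modulo t, passing to the limit along partial products of length
N t. -/
theorem progProd_split {v : R⟦X⟧} (hv : X ∣ v) (a : ℕ) {s t : ℕ} (hs : 0 < s) (ht : 0 < t) :
    progProd v a s = ∏ r ∈ range t, progProd v (a + s * r) (s * t) := by
  refine tendsto_nhds_unique ((multipliable_progProd hv a hs).tendsto_prod_tprod_nat.comp
    (tendsto_id.atTop_mul_const' ht)) ?_
  refine (tendsto_finsetProd (range t) fun r _ => (multipliable_progProd hv (a + s * r)
    (Nat.mul_pos hs ht)).tendsto_prod_tprod_nat).congr fun N => ?_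
  simp only [Function.comp, id]
  rw [prod_range_mul_eq]
  refine prod_congr rfl fun r _ => prod_congr rfl fun k _ => ?_
  congr 2; ring

theorem progProdAdd_mul_progProd {v : R⟦X⟧} (hv : X ∣ v) (a : ℕ) {s : ℕ} (hs : 0 < s) :
    progProdAdd v a s * progProd v a s = progProd v (2 * a) (2 * s) := by
  rw [progProdAdd, progProd, progProd,
    ← (multipliable_progProdAdd hv a hs).tprod_mul (multipliable_progProd hv a hs)]
  refine tprod_congr fun k => ?_
  ring

/-- This is φ(−v) = f₁²/f₂ in v: the triple product gives odd-index factors squared, and those are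
f₁/f₂. -/
theorem theta_neg_one_one {v : R⟦X⟧} (hv : X ∣ v) :
    theta (-v) (-v) * progProd v 2 2 = progProd v 1 1 ^ 2 := by
  have h1 : theta (-v) (-v) = progProd v 2 2 * (progProd v 1 2 * progProd v 1 2) := by
    rw [theta, triple_product hv.neg_right]
    simp only [progProd]
    refine congrArg₂ _ (tprod_congr fun i => ?_) (congrArg₂ _ (tprod_congr fun i => ?_)
      (tprod_congr fun i => ?_)) <;> ring
  have h2 := progProd_split (s := 1) (t := 2) hv 1 (by norm_num) (by norm_num)
  simp only [prod_range_succ, prod_range_zero] at h2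
  norm_num at h2
  rw [h1, h2]; ring

theorem theta_one_zero {v : R⟦X⟧} (hv : X ∣ v) :
    theta v 1 * progProd v 1 1 = 2 * progProd v 2 2 ^ 2 := by
  have h1 : theta v 1 = progProd v 1 1 * (progProdAdd v 1 1 * (2 * progProdAdd v 1 1)) := by
    rw [theta, triple_product hv]
    -- With y = 1 the factor k = 0 equals 2, so the sum over all integers is 2ψ(v).
    have h0 : ∏' k : ℕ, (1 + (1 : R⟦X⟧) * (v * 1) ^ k) = 2 * progProdAdd v 1 1 := by
      refine tendsto_nhds_unique (multipliable_one_add_of_X_pow_dvd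
        (X_pow_dvd_mul_pow (v := v * 1) (c := 1) (by simpa using hv))).tendsto_prod_tprod_nat ?_
      rw [← tendsto_add_atTop_iff_nat 1]
      refine ((multipliable_progProdAdd hv 1 one_pos).tendsto_prod_tprod_nat.const_mul 2).congr
        fun N => ?_
      rw [prod_range_succ']
      simp only [one_mul, mul_one, pow_zero, one_add_one_eq_two, mul_comm _ (2 : R⟦X⟧), add_comm 1]
    rw [h0]
    simp only [progProd, progProdAdd]
    refine congrArg₂ _ (tprod_congr fun i => ?_) (congrArg₂ _ (tprod_congr fun i => ?_) rfl) <;>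
      ring
  have h2 := progProdAdd_mul_progProd hv 1 one_pos
  norm_num at h2
  rw [h1, ← h2]; ring

/-- The factors 1 + vᵏ with k prime to 3 become eta quotients through 1 + w = (1 − w²)/(1 − w). -/
theorem theta_two_one {v : R⟦X⟧} (hv : X ∣ v) :
    theta (v ^ 2) v * (progProd v 1 1 * progProd v 6 6) = progProd v 3 3 ^ 2 * progProd v 2 2 := by
  have h1 : theta (v ^ 2) v = progProd v 3 3 * (progProdAdd v 2 3 * progProdAdd v 1 3) := by
    rw [theta, triple_product (hv.trans (dvd_pow_self v two_ne_zero))]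
    simp only [progProd, progProdAdd]
    refine congrArg₂ _ (tprod_congr fun i => ?_) (congrArg₂ _ (tprod_congr fun i => ?_)
      (tprod_congr fun i => ?_)) <;> ring
  have h2 := progProd_split (s := 1) (t := 3) hv 1 (by norm_num) (by norm_num)
  have h3 := progProd_split (s := 2) (t := 3) hv 2 (by norm_num) (by norm_num)
  have h4 := progProdAdd_mul_progProd hv 1 three_pos
  have h5 := progProdAdd_mul_progProd hv 2 three_pos
  simp only [prod_range_succ, prod_range_zero] at h2 h3
  norm_num at h2 h3 h4 h5
  rw [h1, h2, h3, ← h4, ← h5]; ring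

/-- The residues 1 and 5 are those prime to 6, so inclusion–exclusion over the divisors 2 and 3
gives the eta quotient. -/
theorem theta_neg_five_one {v : R⟦X⟧} (hv : X ∣ v) :
    theta (-v ^ 5) (-v) * (progProd v 2 2 * progProd v 3 3) =
      progProd v 6 6 ^ 2 * progProd v 1 1 := by
  have h1 : theta (-v ^ 5) (-v) = progProd v 6 6 * (progProd v 5 6 * progProd v 1 6) := by
    rw [theta, triple_product (hv.trans (dvd_pow_self v (by norm_num))).neg_right]
    simp only [progProd]
    refine congrArg₂ _ (tprod_congr fun i => ?_) (congrArg₂ _ (tprod_congr fun i => ?_)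
      (tprod_congr fun i => ?_)) <;> ring
  have h2 := progProd_split (s := 1) (t := 6) hv 1 (by norm_num) (by norm_num)
  have h3 := progProd_split (s := 2) (t := 3) hv 2 (by norm_num) (by norm_num)
  have h4 := progProd_split (s := 3) (t := 2) hv 3 (by norm_num) (by norm_num)
  simp only [prod_range_succ, prod_range_zero] at h2 h3 h4
  norm_num at h2 h3 h4
  rw [h1, h2, h3, h4]; ring

end EtaProducts

theorem _root_.HasSum.of_eq {A : Type*} [AddCommMonoid A] [TopologicalSpace A] {ι : Type*}
    {g g' : ι → A} {s : A} (h : HasSum g s) (e : ∀ n, g' n = g n) : HasSum g' s :=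
  (funext e : g' = g) ▸ h

section Trisection

variable {A : Type*} [AddCommMonoid A] [TopologicalSpace A] [ContinuousAdd A]

theorem hasSum_int_trisection {g : ℤ → A} {s₀ s₁ s₂ : A}
    (h₀ : HasSum (fun n => g (3 * n)) s₀) (h₁ : HasSum (fun n => g (3 * n + 1)) s₁)
    (h₂ : HasSum (fun n => g (3 * n + 2)) s₂) : HasSum g (s₀ + s₁ + s₂) := by
  have key : ∀ (r : ℤ) (s : A), 0 ≤ r → r < 3 → HasSum (fun n => g (3 * n + r)) s →
      HasSum (fun n => if n % 3 = r then g n else 0) s := by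
    intro r s hr hr' h
    have hinj : Function.Injective fun n : ℤ => 3 * n + r := fun a b hab => by
      simp only at hab; omega
    rw [← hinj.hasSum_iff]
    · refine h.of_eq fun n => ?_
      simp only [Function.comp]
      rw [if_pos (by omega)]
    · intro n hn
      rw [if_neg]
      intro hc
      exact hn ⟨n / 3, by simp only; omega⟩
  convert ((key 0 s₀ (by norm_num) (by norm_num) (by simpa using h₀)).add
    (key 1 s₁ (by norm_num) (by norm_num) h₁)).add
    (key 2 s₂ (by norm_num) (by norm_num) h₂) using 1
  ext n
  have : n % 3 = 0 ∨ n % 3 = 1 ∨ n % 3 = 2 := by omega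
  rcases this with h | h | h <;> simp [h]

omit [ContinuousAdd A] in
theorem hasSum_neg_sub_one {g : ℤ → A} {s : A} (h : HasSum g s) :
    HasSum (fun n => g (-n - 1)) s :=
  ((Equiv.neg ℤ).trans (Equiv.subRight 1)).hasSum_iff.2 h

end Trisection

section ThetaTrisection

theorem thetaTerm_pow {A : Type*} [CommRing A] (u : A) (a b : ℕ) (n : ℤ) :
    thetaTerm (u ^ a) (u ^ b) n = u ^ (a * tri n + b * tri (-n)) := by
  rw [thetaTerm, pow_add, pow_mul, pow_mul]

variable {A : Type*} [CommRing A] [TopologicalSpace A] [IsTopologicalRing A] [T2Space A]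

/-- The `3`-dissection of `∑ u ^ (n ^ 2)`. -/
theorem theta_one_one_trisection {u : A}
    (hu : ∀ a b, 0 < a → Summable (thetaTerm (u ^ a) (u ^ b))) :
    theta u u = theta (u ^ 9) (u ^ 9) + 2 * (u * theta (u ^ 15) (u ^ 3)) := by
  have h := hasSum_int_trisection (g := thetaTerm (u ^ 1) (u ^ 1))
    (s₀ := theta (u ^ 9) (u ^ 9)) (s₁ := u * theta (u ^ 15) (u ^ 3))
    (s₂ := u * theta (u ^ 15) (u ^ 3)) ?_ ?_ ?_
  · rw [pow_one] at h
    rw [theta, h.tsum_eq]; ring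
  · refine ((hu 9 9 (by norm_num)).hasSum).of_eq fun n => ?_
    rw [thetaTerm_pow, thetaTerm_pow]
    congr 1
    have h1 := two_mul_tri (3 * n)
    have h2 := two_mul_tri (-(3 * n))
    have h3 := two_mul_tri n
    have h4 := two_mul_tri (-n)
    zify; linarith
  · refine (((hu 15 3 (by norm_num)).hasSum).mul_left u).of_eq fun n => ?_
    rw [thetaTerm_pow, thetaTerm_pow, ← pow_succ']
    congr 1
    have h1 := two_mul_tri (3 * n + 1)
    have h2 := two_mul_tri (-(3 * n + 1))
    have h3 := two_mul_tri n
    have h4 := two_mul_tri (-n)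
    zify; linarith
  -- The exponent is n², and 3n + 2 = −(3(−n−1) + 1): class 2 mirrors class 1.
  · refine ((hasSum_neg_sub_one (hu 15 3 (by norm_num)).hasSum).mul_left u).of_eq fun n => ?_
    rw [thetaTerm_pow, thetaTerm_pow, ← pow_succ']
    congr 1
    have h1 := two_mul_tri (3 * n + 2)
    have h2 := two_mul_tri (-(3 * n + 2))
    have h3 := two_mul_tri (-n - 1)
    have h4 := two_mul_tri (-(-n - 1))
    zify; linarith

/-- The `3`-dissection of `∑ u ^ (n (n + 1) / 2)`. -/
theorem theta_one_zero_trisection {u : A}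
    (hu : ∀ a b, 0 < a → Summable (thetaTerm (u ^ a) (u ^ b))) :
    theta u 1 = 2 * theta (u ^ 6) (u ^ 3) + u * theta (u ^ 9) 1 := by
  have h := hasSum_int_trisection (g := thetaTerm (u ^ 1) (u ^ 0))
    (s₀ := theta (u ^ 6) (u ^ 3)) (s₁ := u * theta (u ^ 9) (u ^ 0))
    (s₂ := theta (u ^ 6) (u ^ 3)) ?_ ?_ ?_
  · rw [pow_one, pow_zero] at h
    rw [theta, h.tsum_eq]; ring
  · refine ((hu 6 3 (by norm_num)).hasSum).of_eq fun n => ?_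
    rw [thetaTerm_pow, thetaTerm_pow]
    congr 1
    have h1 := two_mul_tri (3 * n)
    have h3 := two_mul_tri n
    have h4 := two_mul_tri (-n)
    zify; linarith
  · refine (((hu 9 0 (by norm_num)).hasSum).mul_left u).of_eq fun n => ?_
    rw [thetaTerm_pow, thetaTerm_pow, ← pow_succ']
    congr 1
    have h1 := two_mul_tri (3 * n + 1)
    have h3 := two_mul_tri n
    zify; linarith
  -- Triangular numbers are invariant under n ↦ −1 − n, which sends 3n + 2 to 3(−n−1): class 2
  -- mirrors class 0.
  · refine (hasSum_neg_sub_one (hu 6 3 (by norm_num)).hasSum).of_eq fun n => ?_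
    rw [thetaTerm_pow, thetaTerm_pow]
    congr 1
    have h1 := two_mul_tri (3 * n + 2)
    have h3 := two_mul_tri (-n - 1)
    have h4 := two_mul_tri (-(-n - 1))
    zify; linarith

end ThetaTrisection

end RegularCubic

end

/-! ### The 3-dissection of f₁f₂ -/

noncomputable section

namespace RegularCubic

open PowerSeries Finset Filter Topology
open scoped PowerSeries.WithPiTopology

theorem continuous_of_continuous_coeff {R S : Type*} [CommRing R] [CommRing S]
    [TopologicalSpace R] [TopologicalSpace S] {φ : R⟦X⟧ → S⟦X⟧}
    (h : ∀ d, Continuous fun g => coeff d (φ g)) : Continuous φ := by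
  rw [continuous_iff_continuousAt]
  intro g
  rw [ContinuousAt, WithPiTopology.tendsto_iff_coeff_tendsto]
  exact fun d => (h d).tendsto g

/-- The substitution `q ↦ q ^ 3`. -/
abbrev expandThree : ℤ⟦X⟧ →+* ℤ⟦X⟧ := (expand 3 three_ne_zero : ℤ⟦X⟧ →ₐ[ℤ] ℤ⟦X⟧).toRingHom

theorem expandThree_X : expandThree X = X ^ 3 := expand_X 3 three_ne_zero

theorem continuous_expandThree : Continuous expandThree := by
  refine continuous_of_continuous_coeff fun d => ?_
  by_cases h : 3 ∣ d
  · obtain ⟨k, rfl⟩ := h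
    convert WithPiTopology.continuous_coeff ℤ k using 2 with g
    exact coeff_expand_mul 3 three_ne_zero g k
  · convert continuous_const (y := (0 : ℤ)) using 2 with g
    exact coeff_expand_of_not_dvd 3 three_ne_zero g h

theorem f_eq_progProd (k : ℕ) : f k = progProd X k k := by
  rw [f, progProd]
  refine tprod_congr fun i => ?_
  ring

theorem expandThree_f {k : ℕ} (hk : 0 < k) : expandThree (f k) = f (3 * k) := by
  rw [f, (multipliable_f k hk).map_tprod _ continuous_expandThree, f]
  refine tprod_congr fun i => ?_
  rw [map_sub, map_one, map_pow, expandThree_X, ← pow_mul, mul_assoc]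

theorem f_mul_eq_progProd (m k : ℕ) : f (m * k) = progProd (X ^ m) k k := by
  rw [f, progProd]
  refine tprod_congr fun i => ?_
  rw [← pow_mul]; ring

theorem f_ne_zero {k : ℕ} (hk : 0 < k) : f k ≠ 0 := fun h => by
  simpa [h] using constantCoeff_f k hk

/-- The inverse of `f k`. -/
def fInv (k : ℕ) : ℤ⟦X⟧ := invOfUnit (f k) 1

theorem f_mul_fInv {k : ℕ} (hk : 0 < k) : f k * fInv k = 1 :=
  mul_invOfUnit _ _ (by simp [constantCoeff_f k hk])

section Dissection

/-- The component of `f_1 f_2` with exponents divisible by `3`, after `q ^ 3 ↦ q`. -/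
def comp₀ : ℤ⟦X⟧ := f 2 * f 3 ^ 4 * (fInv 1 * fInv 6 ^ 2)

/-- The component of `- f_1 f_2` with exponents congruent to `1` modulo `3`. -/
def comp₁ : ℤ⟦X⟧ := f 3 * f 6

/-- Minus half the component of `f_1 f_2` with exponents congruent to `2` modulo `3`. -/
def comp₂ : ℤ⟦X⟧ := f 1 * f 6 ^ 4 * (fInv 2 * fInv 3 ^ 2)

theorem comp₀_mul : comp₀ * (f 1 * f 6 ^ 2) = f 2 * f 3 ^ 4 := by
  have h1 := f_mul_fInv (k := 1) (by norm_num)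
  have h6 := f_mul_fInv (k := 6) (by norm_num)
  calc comp₀ * (f 1 * f 6 ^ 2) = f 2 * f 3 ^ 4 * (f 1 * fInv 1) * (f 6 * fInv 6) ^ 2 := by
        rw [comp₀]; ring
    _ = _ := by rw [h1, h6]; ring

theorem comp₂_mul : comp₂ * (f 2 * f 3 ^ 2) = f 1 * f 6 ^ 4 := by
  have h2 := f_mul_fInv (k := 2) (by norm_num)
  have h3 := f_mul_fInv (k := 3) (by norm_num)
  calc comp₂ * (f 2 * f 3 ^ 2) = f 1 * f 6 ^ 4 * (f 2 * fInv 2) * (f 3 * fInv 3) ^ 2 := by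
        rw [comp₂]; ring
    _ = _ := by rw [h2, h3]; ring

/-- The eta quotients cancel. This relation makes the norm of f₁f₂ a polynomial in f₁f₂ and q b(q³)
alone. -/
theorem comp₀_mul_comp₂ : comp₀ * comp₂ = comp₁ ^ 2 := by
  have h : f 1 * f 6 ^ 2 * (f 2 * f 3 ^ 2) ≠ 0 := by
    simp [f_ne_zero]
  refine mul_right_cancel₀ h ?_
  rw [comp₁]
  linear_combination comp₂ * (f 2 * f 3 ^ 2) * comp₀_mul + f 2 * f 3 ^ 4 * comp₂_mul

/-- The `3`-dissection of `f_1 f_2`. -/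
theorem f_one_mul_f_two : f 1 * f 2 =
    expandThree comp₀ - X * expandThree comp₁ - 2 * X ^ 2 * expandThree comp₂ := by
  have hX : (X : ℤ⟦X⟧) ∣ X := dvd_rfl
  have hd : ∀ k : ℕ, k ≠ 0 → (X : ℤ⟦X⟧) ∣ X ^ k := fun k hk => dvd_pow_self X hk
  have p1 := theta_neg_one_one hX
  have p2 := theta_one_zero hX
  have p3 := theta_neg_one_one (hd 9 (by norm_num))
  have p4 := theta_one_zero (hd 9 (by norm_num))
  have p5 := theta_two_one (hd 3 (by norm_num))
  have p6 := theta_neg_five_one (hd 3 (by norm_num))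
  simp only [← f_mul_eq_progProd] at p3 p4 p5 p6
  simp only [← f_eq_progProd] at p1 p2
  norm_num at p3 p4 p5 p6
  have t1 := theta_one_one_trisection (u := -(X : ℤ⟦X⟧)) fun a b ha =>
    summable_thetaTerm (hX.neg_right.trans (dvd_pow_self _ ha.ne')) _
  have t2 := theta_one_zero_trisection (u := (X : ℤ⟦X⟧)) fun a b ha =>
    summable_thetaTerm (hd a ha.ne') _
  have e9 : (-(X : ℤ⟦X⟧)) ^ 9 = - X ^ 9 := by ring
  have e15 : (-(X : ℤ⟦X⟧)) ^ 15 = - (X ^ 3) ^ 5 := by ring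
  have e3 : (-(X : ℤ⟦X⟧)) ^ 3 = - X ^ 3 := by ring
  have e6 : (X : ℤ⟦X⟧) ^ 6 = (X ^ 3) ^ 2 := by ring
  rw [e9, e15, e3] at t1
  rw [e6] at t2
  have c0 := congrArg expandThree comp₀_mul
  have c2 := congrArg expandThree comp₂_mul
  simp only [map_mul, map_pow, expandThree_f, Nat.zero_lt_succ, Nat.reduceMul] at c0 c2
  have c1 : expandThree comp₁ = f 9 * f 18 := by
    simp only [comp₁, map_mul, expandThree_f, Nat.zero_lt_succ, Nat.reduceMul]
  generalize theta (-(X : ℤ⟦X⟧)) (-X) = φ₁ at *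
  generalize theta (X : ℤ⟦X⟧) 1 = ψ₁ at *
  generalize theta (-(X : ℤ⟦X⟧) ^ 9) (-X ^ 9) = φ₉ at *
  generalize theta ((X : ℤ⟦X⟧) ^ 9) 1 = ψ₉ at *
  generalize theta (((X : ℤ⟦X⟧) ^ 3) ^ 2) (X ^ 3) = A at *
  generalize theta (-((X : ℤ⟦X⟧) ^ 3) ^ 5) (-X ^ 3) = Ω at *
  -- The product to expand is (φ₉ − 2XΩ)(2A + Xψ₉); its X-term is φ₉ψ₉ − 4ΩA = (2 − 4) f₉f₁₈.
  -- Everything is doubled because ψ₁ denotes 2ψ(q).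
  have g0 : φ₉ * A = expandThree comp₀ := by
    refine mul_right_cancel₀ (b := f 3 * f 18 ^ 2) (by simp [f_ne_zero]) ?_
    linear_combination A * f 3 * f 18 * p3 + f 9 ^ 2 * p5 - c0
  have g1 : Ω * A = f 9 * f 18 := by
    refine mul_right_cancel₀ (b := f 6 * f 9 * (f 3 * f 18)) (by simp [f_ne_zero]) ?_
    linear_combination A * f 3 * f 18 * p6 + f 18 ^ 2 * f 3 * p5
  have g1' : φ₉ * ψ₉ = 2 * (f 9 * f 18) := by
    refine mul_right_cancel₀ (b := f 18 * f 9) (by simp [f_ne_zero]) ?_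
    linear_combination ψ₉ * f 9 * p3 + f 9 ^ 2 * p4
  have g2 : Ω * ψ₉ = 2 * expandThree comp₂ := by
    refine mul_right_cancel₀ (b := f 6 * f 9 ^ 2) (by simp [f_ne_zero]) ?_
    linear_combination ψ₉ * f 9 * p6 + f 18 ^ 2 * f 3 * p4 - 2 * c2
  have g3 : φ₁ * ψ₁ = 2 * (f 1 * f 2) := by
    refine mul_right_cancel₀ (b := f 1 * f 2) (by simp [f_ne_zero]) ?_
    linear_combination ψ₁ * f 1 * p1 + f 1 ^ 2 * p2
  have h2 : (2 : ℤ⟦X⟧) ≠ 0 := by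
    rw [← map_ofNat (PowerSeries.C (R := ℤ)) 2, Ne, map_eq_zero_iff _ C_injective]
    norm_num
  refine mul_left_cancel₀ h2 ?_
  rw [← g3, t1, t2, c1]
  linear_combination 2 * g0 + X * g1' - 4 * X * g1 - 2 * X ^ 2 * g2

end Dissection

/-! ### The norm of f₁f₂ under q ↦ ωq -/

section Norm

/-- The ring homomorphism `g(q) ↦ g(ω q)` to complex power series. -/
def rescaleC (ω : ℂ) : ℤ⟦X⟧ →+* ℂ⟦X⟧ := (rescale ω).comp (PowerSeries.map (Int.castRingHom ℂ))

theorem coeff_rescaleC (ω : ℂ) (d : ℕ) (g : ℤ⟦X⟧) :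
    coeff d (rescaleC ω g) = ω ^ d * ((coeff d g : ℤ) : ℂ) := by
  simp [rescaleC]

theorem rescaleC_X (ω : ℂ) : rescaleC ω X = PowerSeries.C ω * X := by
  simp [rescaleC, rescale_X]

theorem rescaleC_one_injective : Function.Injective (rescaleC 1) := fun g g' h => by
  ext d
  have := congrArg (coeff d) h
  simpa [coeff_rescaleC] using this

theorem rescaleC_expandThree {ω : ℂ} (hω : ω ^ 3 = 1) (g : ℤ⟦X⟧) :
    rescaleC ω (expandThree g) = rescaleC 1 (expandThree g) := by
  ext d
  rw [coeff_rescaleC, coeff_rescaleC]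
  by_cases h : 3 ∣ d
  · obtain ⟨k, rfl⟩ := h
    rw [pow_mul, hω, one_pow, one_pow]
  · have : coeff d (expandThree g) = 0 := coeff_expand_of_not_dvd 3 three_ne_zero g h
    rw [this, Int.cast_zero, mul_zero, mul_zero]

theorem continuous_rescaleC (ω : ℂ) : Continuous (rescaleC ω) := by
  refine continuous_of_continuous_coeff fun d => ?_
  simp only [coeff_rescaleC]
  exact continuous_const.mul ((continuous_of_discreteTopology (f := fun n : ℤ => (n : ℂ))).comp
    (WithPiTopology.continuous_coeff ℤ d))

theorem rescaleC_f (ω : ℂ) {k : ℕ} (hk : 0 < k) :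
    rescaleC ω (f k) = progProd (PowerSeries.C ω * X) k k := by
  rw [f, (multipliable_f k hk).map_tprod _ (continuous_rescaleC ω), progProd]
  refine tprod_congr fun i => ?_
  rw [map_sub, map_one, map_pow, rescaleC_X]
  ring

variable {ω : ℂ} (hω : ω ^ 2 + ω + 1 = 0)
include hω

theorem cube_eq_one : ω ^ 3 = 1 := by linear_combination (ω - 1) * hω

/-- For e prime to 3, ωᵉ is again a primitive cube root of unity, so the product is 1 − (Xᵉ)³. -/
theorem prod_one_sub_rescale {e : ℕ} (he : ¬ 3 ∣ e) :
    (1 - (PowerSeries.C (1 : ℂ) * X) ^ e) * (1 - (PowerSeries.C ω * X) ^ e) *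
      (1 - (PowerSeries.C (ω ^ 2) * X) ^ e) = 1 - (X ^ 3) ^ e := by
  have h3 := cube_eq_one hω
  have hζ : (ω ^ e) ^ 2 + ω ^ e + 1 = 0 := by
    rw [← Nat.div_add_mod e 3, pow_add, pow_mul, h3, one_pow, one_mul]
    have : e % 3 = 1 ∨ e % 3 = 2 := by omega
    rcases this with h | h <;> rw [h]
    · simpa using hω
    · linear_combination (ω ^ 2 - ω + 1) * hω
  have hC := congrArg (PowerSeries.C (R := ℂ)) hζ
  simp only [map_add, map_pow, map_one, map_zero] at hC
  have e1 : (PowerSeries.C (1 : ℂ) * X) ^ e = X ^ e := by rw [map_one, one_mul]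
  have e2 : (PowerSeries.C (ω ^ 2) * X) ^ e = (PowerSeries.C ω ^ e) ^ 2 * X ^ e := by
    rw [map_pow]; ring
  rw [e1, e2, mul_pow, pow_right_comm (X : ℂ⟦X⟧) 3 e]
  generalize (PowerSeries.C ω) ^ e = z at *
  generalize (X : ℂ⟦X⟧) ^ e = x at *
  linear_combination (-x + x ^ 2 * z - x ^ 3 * (z - 1)) * hC

theorem prod_progProd_rescale {a s : ℕ} (hs : 0 < s) (ha : ¬ 3 ∣ a) (hs3 : 3 ∣ s) :
    progProd (PowerSeries.C (1 : ℂ) * X) a s * progProd (PowerSeries.C ω * X) a s *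
      progProd (PowerSeries.C (ω ^ 2) * X) a s = progProd (X ^ 3) a s := by
  have hX : ∀ c : ℂ, X ∣ PowerSeries.C c * X := fun c => dvd_mul_left _ _
  rw [progProd, progProd, progProd, progProd, ← (multipliable_progProd (hX _) a hs).tprod_mul
    (multipliable_progProd (hX _) a hs), ← ((multipliable_progProd (hX _) a hs).mul
    (multipliable_progProd (hX _) a hs)).tprod_mul (multipliable_progProd (hX _) a hs)]
  refine tprod_congr fun k => prod_one_sub_rescale hω ?_
  rwa [← Nat.dvd_add_iff_left (hs3.mul_right k)]

/-- Factors whose exponent is divisible by 3 are fixed by q ↦ ωq and contribute f₃ₖ³; the others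
combine to f₃ₖ/f₉ₖ. -/
theorem norm_f {k : ℕ} (hk : ¬ 3 ∣ k) :
    rescaleC 1 (f k) * rescaleC ω (f k) * rescaleC (ω ^ 2) (f k) * rescaleC 1 (f (3 * (3 * k))) =
      rescaleC 1 (f (3 * k)) ^ 4 := by
  have hk0 : 0 < k := Nat.pos_of_ne_zero (by rintro rfl; simp at hk)
  have hX : ∀ c : ℂ, X ∣ PowerSeries.C c * X := fun c => dvd_mul_left _ _
  have h3 := cube_eq_one hω
  have split : ∀ c : ℂ, c ^ 3 = 1 → rescaleC c (f k) =
      progProd (PowerSeries.C c * X) k (3 * k) * progProd (PowerSeries.C c * X) (2 * k) (3 * k) *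
        rescaleC 1 (f (3 * k)) := by
    intro c hc
    rw [← expandThree_f hk0, ← rescaleC_expandThree hc, expandThree_f hk0,
      rescaleC_f _ hk0, rescaleC_f _ (by omega),
      progProd_split (hX c) k hk0 (t := 3) (by norm_num)]
    simp only [prod_range_succ, prod_range_zero, one_mul]
    ring_nf
  have h9 : rescaleC 1 (f (3 * (3 * k))) = progProd (X ^ 3) (3 * k) (3 * k) := by
    rw [rescaleC_f _ (by omega), progProd, progProd]
    refine tprod_congr fun i => ?_
    simp only [map_one, one_mul]; ring
  have h3k : rescaleC 1 (f (3 * k)) = progProd (X ^ 3) k (3 * k) *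
      progProd (X ^ 3) (2 * k) (3 * k) * progProd (X ^ 3) (3 * k) (3 * k) := by
    have := progProd_split (R := ℂ) (v := X ^ 3) (dvd_pow_self X three_ne_zero) k hk0
      (t := 3) (by norm_num)
    rw [rescaleC_f _ (by omega)]
    simp only [prod_range_succ, prod_range_zero, one_mul] at this
    rw [show k + k * 0 = k by ring, show k + k * 1 = 2 * k by ring,
      show k + k * 2 = 3 * k by ring, mul_comm k 3] at this
    rw [← this, progProd, progProd]
    refine tprod_congr fun i => ?_
    simp only [map_one, one_mul]; ring
  have q1 := prod_progProd_rescale hω (a := k) (s := 3 * k) (by omega) hk (dvd_mul_right _ _)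
  have q2 := prod_progProd_rescale hω (a := 2 * k) (s := 3 * k) (by omega) (by omega)
    (dvd_mul_right _ _)
  rw [split 1 (by norm_num), split ω h3, split (ω ^ 2) (by rw [← pow_mul, mul_comm, pow_mul, h3,
    one_pow]), h9]
  generalize rescaleC 1 (f (3 * k)) = F at *
  generalize progProd ((X : ℂ⟦X⟧) ^ 3) k (3 * k) = p at *
  generalize progProd ((X : ℂ⟦X⟧) ^ 3) (2 * k) (3 * k) = p' at *
  generalize progProd ((X : ℂ⟦X⟧) ^ 3) (3 * k) (3 * k) = p'' at *
  generalize progProd (PowerSeries.C (1 : ℂ) * X) k (3 * k) = a at *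
  generalize progProd (PowerSeries.C ω * X) k (3 * k) = b at *
  generalize progProd (PowerSeries.C (ω ^ 2) * X) k (3 * k) = c at *
  generalize progProd (PowerSeries.C (1 : ℂ) * X) (2 * k) (3 * k) = a' at *
  generalize progProd (PowerSeries.C ω * X) (2 * k) (3 * k) = b' at *
  generalize progProd (PowerSeries.C (ω ^ 2) * X) (2 * k) (3 * k) = c' at *
  linear_combination F ^ 3 * p'' * (a' * b' * c') * q1 + F ^ 3 * p'' * p * q2 - F ^ 3 * h3k

end Norm

/-- The norm of `f_1 f_2` over the power series in `q ^ 3`, written with `q` for `q ^ 3`. -/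
def normThree : ℤ⟦X⟧ := comp₀ ^ 3 - 7 * X * comp₁ ^ 3 - 8 * X ^ 2 * comp₂ ^ 3

/-- The product of the three conjugates of f₁f₂ is computed twice: from the dissection and from
`norm_f`. -/
theorem expandThree_normThree_mul :
    expandThree normThree * (f 9 * f 18) = f 3 ^ 4 * f 6 ^ 4 := by
  obtain ⟨ω, hω⟩ : ∃ ω : ℂ, ω ^ 2 + ω + 1 = 0 := by
    obtain ⟨ω, h⟩ := IsAlgClosed.exists_pow_nat_eq (-3 : ℂ) two_pos
    exact ⟨(-1 + ω) / 2, by linear_combination h / 4⟩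
  have h3 := cube_eq_one hω
  have h6 : (ω ^ 2) ^ 3 = 1 := by rw [← pow_mul, mul_comm, pow_mul, h3, one_pow]
  refine rescaleC_one_injective ?_
  have n1 := norm_f hω (k := 1) (by norm_num)
  have n2 := norm_f hω (k := 2) (by norm_num)
  have d1 := congrArg (rescaleC 1) f_one_mul_f_two
  have d2 := congrArg (rescaleC ω) f_one_mul_f_two
  have d3 := congrArg (rescaleC (ω ^ 2)) f_one_mul_f_two
  have hac := congrArg (fun g => rescaleC 1 (expandThree g)) comp₀_mul_comp₂
  have hC := congrArg (PowerSeries.C (R := ℂ)) hω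
  simp only [map_add, map_pow, map_one, map_zero] at hC
  simp only [normThree, map_mul, map_pow, map_sub, rescaleC_expandThree h3,
    rescaleC_expandThree h6, rescaleC_X, expandThree_X, map_one, one_mul, map_ofNat] at *
  generalize rescaleC 1 (expandThree comp₀) = a at *
  generalize rescaleC 1 (expandThree comp₁) = b at *
  generalize rescaleC 1 (expandThree comp₂) = c at *
  generalize (PowerSeries.C ω) = z at *
  -- The general norm form has −b³ − 6abc at X³; ac = b² turns this into −7b³.
  have key : (a - X * b - 2 * X ^ 2 * c) * (a - z * X * b - 2 * (z * X) ^ 2 * c) *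
      (a - z ^ 2 * X * b - 2 * (z ^ 2 * X) ^ 2 * c) =
      a ^ 3 - 7 * X ^ 3 * b ^ 3 - 8 * (X ^ 3) ^ 2 * c ^ 3 := by
    have e1 : (z * X) ^ 2 = (-1 - z) * X ^ 2 := by linear_combination X ^ 2 * hC
    have e2 : (z ^ 2 * X) ^ 2 = z * X ^ 2 := by linear_combination (z ^ 2 - z) * X ^ 2 * hC
    have e3 : z ^ 2 = -1 - z := by linear_combination hC
    rw [e1, e2, e3]
    linear_combination -(a - X * b - 2 * X ^ 2 * c) * (X * b - 2 * X ^ 2 * c) ^ 2 * hC -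
      6 * X ^ 3 * b * hac
  rw [← key, ← d1, ← d2, ← d3]
  norm_num at n1 n2
  linear_combination n1 * (rescaleC 1 (f 2) * rescaleC ω (f 2) * rescaleC (ω ^ 2) (f 2) *
    rescaleC 1 (f 18)) + rescaleC 1 (f 3) ^ 4 * n2

end RegularCubic

end

/-! ### The operator U and the modular equation -/

noncomputable section

namespace RegularCubic

open PowerSeries Finset

/-- The operator `∑ a(n) q ^ n ↦ ∑ a(3 n) q ^ n`. -/
def extractThree : ℤ⟦X⟧ →+ ℤ⟦X⟧ where
  toFun g := PowerSeries.mk fun n => coeff (3 * n) g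
  map_zero' := by ext; simp
  map_add' g h := by ext; simp

@[simp]
theorem coeff_extractThree (g : ℤ⟦X⟧) (n : ℕ) : coeff n (extractThree g) = coeff (3 * n) g := by
  change coeff n (PowerSeries.mk fun n => coeff (3 * n) g) = _
  rw [coeff_mk]

/-- Linearity of U over series in q³: only indices divisible by 3 contribute from the first factor,
which forces the same for the second. -/
theorem extractThree_expandThree_mul (g h : ℤ⟦X⟧) :
    extractThree (expandThree g * h) = g * extractThree h := by
  ext n
  rw [coeff_extractThree, coeff_mul, coeff_mul]
  symm
  refine sum_of_injOn (fun p => (3 * p.1, 3 * p.2)) ?_ ?_ ?_ ?_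
  · rintro ⟨a, b⟩ - ⟨c, d⟩ - h
    simp only [Prod.mk.injEq] at h ⊢
    omega
  · rintro ⟨a, b⟩ h
    simp only [mem_coe, HasAntidiagonal.mem_antidiagonal] at h ⊢
    omega
  · rintro ⟨a, b⟩ hp hn
    rw [HasAntidiagonal.mem_antidiagonal] at hp
    simp only at hp
    have : ¬ 3 ∣ a := by
      rintro ⟨c, rfl⟩
      refine hn ⟨(c, n - c), ?_, ?_⟩
      · simp only [mem_coe, HasAntidiagonal.mem_antidiagonal]; omega
      · simp only [Prod.mk.injEq, true_and]; omega
    have h0 : coeff a (expandThree g) = 0 := coeff_expand_of_not_dvd 3 three_ne_zero g this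
    rw [h0, zero_mul]
  · rintro ⟨a, b⟩ -
    rw [coeff_extractThree]
    congr 1
    exact (coeff_expand_mul 3 three_ne_zero g a).symm

theorem extractThree_expandThree_mul_X_pow {k : ℕ} (hk : ¬ 3 ∣ k) (g : ℤ⟦X⟧) :
    extractThree (expandThree g * X ^ k) = 0 := by
  have : extractThree (X ^ k) = 0 := by
    ext n
    rw [coeff_extractThree, coeff_X_pow, if_neg (by omega), map_zero]
  rw [extractThree_expandThree_mul, this, mul_zero]

theorem extractThree_expandThree (g : ℤ⟦X⟧) : extractThree (expandThree g) = g := by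
  have : extractThree 1 = 1 := by
    ext n
    simp [coeff_one]
  simpa [this] using extractThree_expandThree_mul g 1

theorem extractThree_expandThree_mul_X_cube (g : ℤ⟦X⟧) :
    extractThree (expandThree g * X ^ 3) = X * g := by
  rw [← expandThree_X, ← map_mul, extractThree_expandThree, mul_comm]

theorem extractThree_C_mul (c : ℤ) (g : ℤ⟦X⟧) :
    extractThree (PowerSeries.C c * g) = PowerSeries.C c * extractThree g := by
  ext n
  rw [coeff_extractThree, coeff_C_mul, coeff_C_mul, coeff_extractThree]

/-- The series `q f_9 f_18 / (f_1 f_2)`. -/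
def shiftedGen : ℤ⟦X⟧ := X * PowerSeries.mk fun n => (a9 n : ℤ)

/-- The series `q (f_3 f_6 / (f_1 f_2)) ^ 4`. -/
def hauptmodul : ℤ⟦X⟧ := X * quot ^ 4

theorem quot_mul : quot * (f 1 * f 2) = f 3 * f 6 := by
  rw [quot, mul_assoc, mul_comm (invOfUnit _ _), f_one_mul_f_two_mul_invOfUnit, mul_one]

theorem mk_a9_mul : (PowerSeries.mk fun n => (a9 n : ℤ)) * (f 1 * f 2) = f 9 * f 18 := by
  rw [mk_a9, mul_assoc, mul_comm (invOfUnit _ _), f_one_mul_f_two_mul_invOfUnit, mul_one]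

theorem expandThree_comp₁ : expandThree comp₁ = f 9 * f 18 := by
  simp only [comp₁, map_mul, expandThree_f, Nat.zero_lt_succ, Nat.reduceMul]

theorem expandThree_quot_mul : expandThree quot * (f 3 * f 6) = f 9 * f 18 := by
  have := congrArg expandThree quot_mul
  simpa only [map_mul, expandThree_f, Nat.zero_lt_succ, Nat.reduceMul] using this

/-- Telescoping: (f₃f₆/f₁f₂)(f₉f₁₈/f₃f₆). Its fourth power is the link z⁴ = t(q³) t. -/
theorem quot_mul_expandThree_quot :
    quot * expandThree quot = PowerSeries.mk fun n => (a9 n : ℤ) := by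
  refine mul_right_cancel₀ (b := f 1 * f 2 * (f 3 * f 6)) (by simp [f_ne_zero]) ?_
  linear_combination expandThree quot * (f 3 * f 6) * quot_mul + f 3 * f 6 * expandThree_quot_mul -
    f 3 * f 6 * mk_a9_mul

theorem shiftedGen_pow_four_mul (i : ℕ) :
    shiftedGen ^ (4 * i) = expandThree (hauptmodul ^ i) * hauptmodul ^ i := by
  rw [map_pow, ← mul_pow, pow_mul]
  congr 1
  rw [hauptmodul, map_mul, map_pow, expandThree_X, shiftedGen, ← quot_mul_expandThree_quot]
  ring

theorem hauptmodul_ne_zero : hauptmodul ≠ 0 := by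
  refine mul_ne_zero X_ne_zero (pow_ne_zero _ fun h => ?_)
  have := quot_mul
  rw [h, zero_mul] at this
  exact mul_ne_zero (f_ne_zero three_pos) (f_ne_zero (k := 6) (by norm_num)) this.symm

theorem expandThree_quot_pow_mul :
    expandThree (quot ^ 4) * expandThree normThree = expandThree comp₁ ^ 3 := by
  refine mul_right_cancel₀ (b := f 9 * f 18) (by simp [f_ne_zero]) ?_
  rw [mul_assoc, expandThree_normThree_mul, map_pow, expandThree_comp₁, ← mul_pow, ← mul_pow,
    expandThree_quot_mul]
  ring

/-- Put y = q b(q³) and S = f₁f₂ + y = a − 2q²c. By ac = b² the norm is S³ + 6y²S − 7y³, which has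
the factor S − y = f₁f₂. -/
theorem expandThree_normThree : expandThree normThree = f 1 * f 2 * ((f 1 * f 2) ^ 2 +
    3 * X * expandThree comp₁ * (f 1 * f 2) + 9 * X ^ 2 * expandThree comp₁ ^ 2) := by
  have h := congrArg expandThree comp₀_mul_comp₂
  simp only [map_mul, map_pow] at h
  simp only [normThree, map_sub, map_mul, map_pow, map_ofNat, expandThree_X, f_one_mul_f_two]
  generalize expandThree comp₀ = a at *
  generalize expandThree comp₁ = b at *
  generalize expandThree comp₂ = c at *
  linear_combination 6 * X ^ 2 * (a - 2 * X ^ 2 * c) * h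

theorem shiftedGen_mul : shiftedGen * (f 1 * f 2) = X * expandThree comp₁ := by
  rw [shiftedGen, mul_assoc, mk_a9_mul, expandThree_comp₁]

theorem f_one_mul_f_two_ne_zero : f 1 * f 2 ≠ 0 := by simp [f_ne_zero]

theorem comp₁_ne_zero : comp₁ ≠ 0 := by simp [comp₁, f_ne_zero]

/-- Rewrites z without 1/(f₁f₂), so that the dissection of f₁f₂ applies to it. -/
theorem comp₁_sq_mul_shiftedGen : expandThree comp₁ ^ 2 * shiftedGen = X * expandThree (quot ^ 4) *
    ((f 1 * f 2) ^ 2 + 3 * X * expandThree comp₁ * (f 1 * f 2) +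
      9 * X ^ 2 * expandThree comp₁ ^ 2) := by
  refine mul_right_cancel₀ f_one_mul_f_two_ne_zero ?_
  linear_combination expandThree comp₁ ^ 2 * shiftedGen_mul - X * expandThree_quot_pow_mul +
    X * expandThree (quot ^ 4) * expandThree_normThree

/-- The previous identity times z, reduced by z f₁f₂ = q b(q³); one more such step yields the
modular equation. -/
theorem comp₁_mul_shiftedGen_sq : expandThree comp₁ * shiftedGen ^ 2 =
    X ^ 2 * expandThree (quot ^ 4) *
      (9 * X * expandThree comp₁ * shiftedGen + 3 * X * expandThree comp₁ + f 1 * f 2) := by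
  refine mul_right_cancel₀ (pow_ne_zero 2 f_one_mul_f_two_ne_zero) ?_
  linear_combination (expandThree comp₁ * (shiftedGen * (f 1 * f 2) + X * expandThree comp₁) -
    9 * X ^ 3 * expandThree (quot ^ 4) * expandThree comp₁ * (f 1 * f 2)) * shiftedGen_mul -
    X ^ 2 * expandThree_quot_pow_mul + X ^ 2 * expandThree (quot ^ 4) * expandThree_normThree

/-- The modular equation of `shiftedGen` over `hauptmodul (q ^ 3)`. -/
theorem shiftedGen_cube : shiftedGen ^ 3 =
    expandThree hauptmodul * (9 * shiftedGen ^ 2 + 3 * shiftedGen + 1) := by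
  refine mul_left_cancel₀ (a := expandThree comp₁)
    (by rw [expandThree_comp₁]; simp [f_ne_zero]) ?_
  rw [hauptmodul, map_mul, expandThree_X]
  linear_combination shiftedGen * comp₁_mul_shiftedGen_sq +
    X ^ 2 * expandThree (quot ^ 4) * shiftedGen_mul

theorem extractThree_shiftedGen : extractThree shiftedGen = 3 * hauptmodul := by
  refine mul_left_cancel₀ (pow_ne_zero 2 comp₁_ne_zero) ?_
  have h := congrArg expandThree comp₀_mul_comp₂
  simp only [map_mul, map_pow] at h
  rw [← extractThree_expandThree_mul, map_pow, comp₁_sq_mul_shiftedGen]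
  -- Sorted by residue of the exponent, only X³ survives U; its coefficient of b² is (1 − 4) − 3 + 9
  -- = 3.
  have e : X * expandThree (quot ^ 4) * ((f 1 * f 2) ^ 2 + 3 * X * expandThree comp₁ * (f 1 * f 2) +
      9 * X ^ 2 * expandThree comp₁ ^ 2) =
      expandThree (quot ^ 4 * comp₀ ^ 2) * X ^ 1 +
      expandThree (quot ^ 4 * (comp₀ * comp₁)) * X ^ 2 +
      expandThree (quot ^ 4 * (3 * comp₁ ^ 2)) * X ^ 3 +
      expandThree (quot ^ 4 * (-2 * comp₁ * comp₂)) * X ^ 4 +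
      expandThree (quot ^ 4 * (4 * comp₂ ^ 2)) * X ^ 5 := by
    simp only [map_mul, map_pow, map_neg, map_ofNat, f_one_mul_f_two]
    linear_combination -4 * X ^ 3 * expandThree quot ^ 4 * h
  rw [e]
  simp only [map_add]
  rw [extractThree_expandThree_mul_X_pow (by norm_num),
    extractThree_expandThree_mul_X_pow (by norm_num), extractThree_expandThree_mul_X_cube,
    extractThree_expandThree_mul_X_pow (by norm_num),
    extractThree_expandThree_mul_X_pow (by norm_num), hauptmodul]
  ring

theorem extractThree_shiftedGen_sq :
    extractThree (shiftedGen ^ 2) = 2 * hauptmodul + 27 * hauptmodul ^ 2 := by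
  refine mul_left_cancel₀ comp₁_ne_zero ?_
  rw [← extractThree_expandThree_mul, comp₁_mul_shiftedGen_sq]
  -- Under U the z-term yields 9t · 3t = 27t², and the X³-term, with 3b − b = 2b, yields 2t.
  have e : X ^ 2 * expandThree (quot ^ 4) *
      (9 * X * expandThree comp₁ * shiftedGen + 3 * X * expandThree comp₁ + f 1 * f 2) =
      expandThree (9 * hauptmodul * comp₁) * shiftedGen +
      expandThree (quot ^ 4 * comp₀) * X ^ 2 +
      expandThree (quot ^ 4 * (2 * comp₁)) * X ^ 3 +
      expandThree (quot ^ 4 * (-2 * comp₂)) * X ^ 4 := by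
    simp only [hauptmodul, map_mul, map_pow, map_neg, map_ofNat, f_one_mul_f_two, expandThree_X]
    ring
  rw [e]
  simp only [map_add]
  rw [extractThree_expandThree_mul, extractThree_shiftedGen,
    extractThree_expandThree_mul_X_pow (by norm_num), extractThree_expandThree_mul_X_cube,
    extractThree_expandThree_mul_X_pow (by norm_num), hauptmodul]
  ring

theorem extractThree_shiftedGen_pow_add_three (i : ℕ) : extractThree (shiftedGen ^ (i + 3)) =
    hauptmodul * (9 * extractThree (shiftedGen ^ (i + 2)) +
      3 * extractThree (shiftedGen ^ (i + 1)) + extractThree (shiftedGen ^ i)) := by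
  have e : shiftedGen ^ (i + 3) = expandThree hauptmodul *
      (expandThree 9 * shiftedGen ^ (i + 2) + expandThree 3 * shiftedGen ^ (i + 1) +
        shiftedGen ^ i) := by
    simp only [map_ofNat]
    linear_combination shiftedGen ^ i * shiftedGen_cube
  rw [e, extractThree_expandThree_mul]
  simp only [map_add, extractThree_expandThree_mul]

/-! ### The matrices `m` and `C` as the action of U -/

theorem m_zero_right : ∀ i, m i 0 = 0
  | 0 | 1 | 2 | 3 | _ + 4 => by simp [m]

theorem m_add_four_succ (i j : ℕ) :
    m (i + 4) (j + 1) = 9 * m (i + 3) j + 3 * m (i + 2) j + m (i + 1) j := by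
  cases j with
  | zero => simp [m_zero_right, m]
  | succ j => rw [m]

/-- Each step of the recurrence lowers j by 1 and i by at most 3. Hence U(z⁴ⁱ) has no terms tʲ with
j ≤ i, and tⁱ can be cancelled. -/
theorem m_eq_zero_of_three_mul_lt : ∀ i j : ℕ, 3 * j < i → m i j = 0
  | i, 0, _ => m_zero_right i
  | i + 4, j + 1, h => by
    rw [m_add_four_succ, m_eq_zero_of_three_mul_lt (i + 3) j (by omega),
      m_eq_zero_of_three_mul_lt (i + 2) j (by omega),
      m_eq_zero_of_three_mul_lt (i + 1) j (by omega)]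
    simp
  | 0, j + 1, h | 1, j + 1, h | 2, j + 1, h | 3, j + 1, h => by omega

/-- U applied to the modular equation is the recurrence of `m`. The free bound B lets three
consecutive rows share one range. -/
theorem extractThree_shiftedGen_pow : ∀ i B : ℕ, 0 < i → i < B → extractThree (shiftedGen ^ i) =
    ∑ j ∈ range B, PowerSeries.C (m i j) * hauptmodul ^ j
  | 1, B + 2, _, _ => by
    rw [sum_range_succ', sum_range_succ', sum_eq_zero fun j _ => by
      rw [m_eq_zero_of_lt _ _ (by omega), map_zero, zero_mul]]
    simp [m, extractThree_shiftedGen]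
  | 2, B + 3, _, _ => by
    rw [sum_range_succ', sum_range_succ', sum_range_succ', sum_eq_zero fun j _ => by
      rw [m_eq_zero_of_lt _ _ (by omega), map_zero, zero_mul]]
    simp [m, extractThree_shiftedGen_sq]
    ring
  | 3, B + 4, _, _ => by
    -- Row 3 needs U(z⁰) = 1, which the zero-filled row 0 of `m` does not encode; hence a separate
    -- case.
    have h1 : extractThree 1 = 1 := by
      simpa using extractThree_expandThree 1
    rw [sum_range_succ', sum_range_succ', sum_range_succ', sum_range_succ',
      sum_eq_zero fun j _ => by
      rw [m_eq_zero_of_lt _ _ (by omega), map_zero, zero_mul]]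
    have := extractThree_shiftedGen_pow_add_three 0
    simp [m, extractThree_shiftedGen_sq, extractThree_shiftedGen, h1] at this ⊢
    rw [this]
    ring
  | i + 4, B + 1, _, hB => by
    rw [extractThree_shiftedGen_pow_add_three, extractThree_shiftedGen_pow (i + 3) B (by omega)
      (by omega), extractThree_shiftedGen_pow (i + 2) B (by omega) (by omega),
      extractThree_shiftedGen_pow (i + 1) B (by omega) (by omega), sum_range_succ', m_zero_right,
      map_zero, zero_mul, add_zero, mul_sum, mul_sum, ← sum_add_distrib, ← sum_add_distrib, mul_sum]
    refine sum_congr rfl fun j _ => ?_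
    rw [m_add_four_succ]
    simp only [map_add, map_mul, map_ofNat]
    ring

/-- From tⁱ U(tⁱ) = U(t(q³)ⁱ tⁱ) = U(z⁴ⁱ), dividing by tⁱ shifts the column index by i. -/
theorem extractThree_hauptmodul_pow {i B : ℕ} (hi : 0 < i) (hB : 3 * i < B) :
    extractThree (hauptmodul ^ i) =
      ∑ j ∈ range B, PowerSeries.C (m (4 * i) (i + j)) * hauptmodul ^ j := by
  refine mul_left_cancel₀ (pow_ne_zero i hauptmodul_ne_zero) ?_
  rw [← extractThree_expandThree_mul, ← shiftedGen_pow_four_mul,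
    extractThree_shiftedGen_pow (4 * i) (i + B) (by omega) (by omega), sum_range_add,
    sum_eq_zero fun j hj => by
      rw [m_eq_zero_of_three_mul_lt _ _ (by have := mem_range.1 hj; omega), map_zero, zero_mul],
    zero_add, mul_sum]
  refine sum_congr rfl fun j _ => ?_
  ring

theorem sum_range_succ_eq_sum_pnat {A : Type*} [AddCommMonoid A] {g : ℕ → A} (h0 : g 0 = 0)
    (B : ℕ+) : ∑ j ∈ range (B + 1), g j = ∑ j ∈ Icc 1 B, g (j : ℕ) := by
  symm
  refine sum_of_injOn (fun j : ℕ+ => (j : ℕ)) PNat.coe_injective.injOn ?_ ?_ fun _ _ => rfl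
  · intro j hj
    simp only [coe_Icc, Set.mem_Icc, ← PNat.coe_le_coe] at hj
    simp only [coe_range, Set.mem_Iio]
    omega
  · intro j hj hn
    rcases Nat.eq_zero_or_pos j with rfl | hpos
    · exact h0
    · have hj' : j ≤ B := Nat.lt_succ_iff.1 (mem_range.1 hj)
      exact absurd ⟨⟨j, hpos⟩, mem_coe.2 (mem_Icc.2 ⟨one_le, hj'⟩), rfl⟩ hn

theorem extractThree_hauptmodul_pow_pnat {i B : ℕ+} (hB : 3 * (i : ℕ) ≤ B) :
    extractThree (hauptmodul ^ (i : ℕ)) =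
      ∑ j ∈ Icc 1 B, PowerSeries.C (C i j) * hauptmodul ^ (j : ℕ) := by
  rw [extractThree_hauptmodul_pow i.pos (Nat.lt_succ_of_le hB), sum_range_succ_eq_sum_pnat]
  · rfl
  · rw [m_eq_zero_of_three_mul_lt _ _ (by have := i.pos; omega), map_zero, zero_mul]

/-- The extra factor q moves the progression 3n + 2 to 3(n + 1), where U can read it. -/
theorem X_mul_mk_eq_extractThree {c d : ℕ → ℤ} (h : ∀ n, d n = c (3 * n + 2)) :
    X * PowerSeries.mk d = extractThree (X * PowerSeries.mk c) := by
  ext n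
  cases n with
  | zero => simp
  | succ n =>
    rw [coeff_extractThree, coeff_succ_X_mul, show 3 * (n + 1) = 3 * n + 2 + 1 by ring,
      coeff_succ_X_mul, coeff_mk, coeff_mk, h]

theorem support_Y_subset (α : ℕ) {B : ℕ+} (hB : 3 ^ α ≤ (B : ℕ)) :
    Function.support (Y α) ⊆ Icc 1 B := by
  intro i hi
  rw [coe_Icc, Set.mem_Icc, ← PNat.coe_le_coe, ← PNat.coe_le_coe]
  by_contra hc
  refine hi (Y_eq_zero α i ?_)
  have := i.pos
  simp only [PNat.one_coe] at hc
  omega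

theorem X_mul_mk_a9 (α : ℕ) (B : ℕ+) (hB : (B : ℕ) = 3 ^ α) :
    X * (PowerSeries.mk fun n : ℕ => (a9 (3 ^ (α + 1) * n + 3 ^ (α + 1) - 1) : ℤ)) =
      ∑ i ∈ Icc 1 B, PowerSeries.C (Y α i) * hauptmodul ^ (i : ℕ) := by
  induction α generalizing B with
  | zero =>
    obtain rfl : B = 1 := PNat.coe_injective (by simpa using hB)
    rw [X_mul_mk_eq_extractThree (c := fun n => (a9 n : ℤ)) fun n => by congr 2]
    simpa [Y, shiftedGen] using extractThree_shiftedGen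
  | succ α ih =>
    set B' : ℕ+ := ⟨3 ^ α, by positivity⟩
    rw [X_mul_mk_eq_extractThree (c := fun n => (a9 (3 ^ (α + 1) * n + 3 ^ (α + 1) - 1) : ℤ))
      fun n => by congr 3; ring, ih B' rfl, map_sum]
    have hY : ∀ j, Y (α + 1) j = ∑ i ∈ Icc 1 B', Y α i * C i j := fun j =>
      finsum_eq_sum_of_support_subset _ ((Function.support_mul_subset_left _ _).trans
        (support_Y_subset α le_rfl))
    simp only [hY, map_sum, sum_mul]
    rw [sum_comm]
    refine sum_congr rfl fun i hi => ?_
    have hi' : (i : ℕ) ≤ 3 ^ α := (mem_Icc.1 hi).2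
    rw [extractThree_C_mul, extractThree_hauptmodul_pow_pnat (B := B)
      (by rw [hB, pow_succ]; omega), mul_sum]
    refine sum_congr rfl fun j _ => ?_
    rw [map_mul, mul_assoc]

end RegularCubic

end

/-! ### The theorem, after cancelling one factor q -/

theorem mainTheorem4 (α : ℕ) :
    (PowerSeries.mk fun n : ℕ => (RegularCubic.a9 (3 ^ (α + 1) * n + 3 ^ (α + 1) - 1) : ℤ)) =
      ∑ᶠ i : ℕ+, PowerSeries.C (RegularCubic.Y α i) * PowerSeries.X ^ ((i : ℕ) - 1) *
        RegularCubic.quot ^ (4 * (i : ℕ)) := by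
  have hpos : 0 < 3 ^ α := by positivity
  refine mul_left_cancel₀ (PowerSeries.X_ne_zero (R := ℤ)) ?_
  rw [RegularCubic.X_mul_mk_a9 α ⟨3 ^ α, hpos⟩ rfl,
    finsum_eq_sum_of_support_subset (s := Finset.Icc (1 : ℕ+) ⟨3 ^ α, hpos⟩), Finset.mul_sum]
  · refine Finset.sum_congr rfl fun i _ => ?_
    have hi : PowerSeries.X ^ (i : ℕ) = PowerSeries.X * (PowerSeries.X : PowerSeries ℤ) ^
        ((i : ℕ) - 1) := by
      rw [← pow_succ', Nat.sub_add_cancel i.pos]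
    rw [RegularCubic.hauptmodul, mul_pow, hi, ← pow_mul]
    ring
  · intro i hi
    refine RegularCubic.support_Y_subset α (B := ⟨3 ^ α, hpos⟩) le_rfl fun hY => hi ?_
    simp only [hY, map_zero, zero_mul]
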